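/- A Peano continuum is a nonempty compact connected metrizable topological space that is locally connected. Let $X$ be a Peano continuum, let $d$ be any metric on $X$ inducing its topology, and let $\varepsilon>0$. Then there exists a finite family $\mathcal F$ of subsets of $X$ such that $\bigcup\mathcal F=X$; each $F\in\mathcal F$, with the subspace topology, is a Peano continuum; $\operatorname{mesh}\mathcal F=\sup\{\operatorname{diam}F: F\in\mathcal F\}\le\varepsilon$, where diameters are taken with respect to $d$; each $F\in\mathcal F$ has nonempty interior in $X$; and the interiors in $X$ of distinct members of $\mathcal F$ are disjoint. -/

import Mathlib

/-- A Peano continuum: a (nonempty) compact connected metrizable space that is locally connected. -/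
structure IsPeanoContinuum (X : Type*) [TopologicalSpace X] : Prop where
  compact : CompactSpace X
  connected : ConnectedSpace X
  metrizable : TopologicalSpace.MetrizableSpace X
  locallyConnected : LocallyConnectedSpace X

/-- The mesh of a family of subsets of a metric space: the supremum of the diameters of its
members, taken in the extended nonnegative reals. -/
noncomputable def mesh {X : Type*} [MetricSpace X] (F : Set (Set X)) : ENNReal :=
  ⨆ A ∈ F, Metric.ediam A

/-!
The pieces are the closures of disjoint connected open sets `U p` with property S whose union is
dense (`exists_dense_partition_hasPropertyS`). Property S passes to closures and makes a closed set
locally connected, so these closures are Peano continua; closures of disjoint open sets have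
disjoint interiors.

The sets `U p` grow from the points `p` of a finite dense enough set. At stage `k` there are
disjoint compact sets `D k p`; they are enlarged to disjoint compact neighbourhoods `D (k + 1) p`,
much denser in the space, such that every new point is joined to `D k p` by a connected subset of
`D (k + 1) p` within distance `η / 2 ^ (k + 1)` (`exists_enlargement`). Since these distances are
summable, `U p = ⋃ k, D k p` is connected and has property S: up to small attachments it is the
compact set `D k p`, which is covered by finitely many small connected subsets of `U p`.

The difficulty is to bound the size of the attachments. Every point `x` has a small connected
neighbourhood `V x` meeting some `D p`, but the growth of another piece may have cut `x` off from
it; joining `x` to whatever blocks the way produces chains of uncontrolled size. Hence each piece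
is divided into parts, one for each ball of a finite cover by balls of radius `δ`, and a part may
absorb points only by connected sets inside its own ball, slightly enlarged. If `x` cannot be
absorbed, then `V x` meets the boundary region of the ball of some part that is visible from `x`.
After a small increase of all radii `V x` lies inside that ball, so that a given ball obstructs
`x` at most once; after as many increases as there are balls everything is absorbed
(`IsAttachedFamily.exists_subset_iUnion`). The number of balls depends on `δ` alone, so if the sets
`V x` are small enough the radii stay at most `2 * δ`.
-/

open Set Metric Topology

/-! ### Property S and local connectedness -/

/-- Property S of continuum theory: for every `r > 0` the set is a finite union of preconnected
sets, each contained in a closed ball of radius `r`. -/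
def HasPropertyS {X : Type*} [MetricSpace X] (U : Set X) : Prop :=
  ∀ r > 0, ∃ s : Set (Set X), s.Finite ∧ ⋃₀ s = U ∧
    ∀ K ∈ s, IsPreconnected K ∧ ∃ z, K ⊆ closedBall z r

theorem hasPropertyS_closure {X : Type*} [MetricSpace X] {U : Set X} (h : HasPropertyS U) :
    HasPropertyS (closure U) := by
  intro r hr
  obtain ⟨s, hs, hU, hK⟩ := h r hr
  refine ⟨closure '' s, hs.image _, ?_, ?_⟩
  · rw [sUnion_image, ← hs.closure_biUnion, ← sUnion_eq_biUnion, hU]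
  · rintro _ ⟨K, hKs, rfl⟩
    obtain ⟨h1, z, h2⟩ := hK K hKs
    exact ⟨h1.closure, z, closure_minimal h2 isClosed_closedBall⟩

/-- A closed set with property S is locally connected: the union of those of the finitely many
small connected closed pieces that contain a given point is a small connected neighbourhood
of it, because the other pieces form a closed set missing the point. -/
theorem HasPropertyS.locallyConnectedSpace {X : Type*} [MetricSpace X] {A : Set X}
    (h : HasPropertyS A) (hA : IsClosed A) : LocallyConnectedSpace A := by
  rw [locallyConnectedSpace_iff_connected_subsets]
  intro x U hU
  obtain ⟨r, hr, hrU⟩ := Metric.mem_nhds_iff.1 hU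
  obtain ⟨s, hs, hsA, hK⟩ := h (r / 3) (by positivity)
  have hclA : ∀ K ∈ s, closure K ⊆ A := fun K hKs =>
    closure_minimal (hsA ▸ subset_sUnion_of_mem hKs) hA
  set t : Set (Set X) := {K ∈ s | (x : X) ∈ closure K} with ht
  set W : Set X := ⋃ K ∈ t, closure K with hW
  have hWA : W ⊆ A := iUnion₂_subset fun K hKt => hclA K hKt.1
  have hWc : IsPreconnected W := by
    rw [hW, ← sUnion_image]
    refine isPreconnected_sUnion (x : X) _ ?_ ?_
    · rintro _ ⟨K, hKt, rfl⟩; exact hKt.2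
    · rintro _ ⟨K, hKt, rfl⟩; exact (hK K hKt.1).1.closure
  refine ⟨(↑) ⁻¹' W, ?_, ?_, ?_⟩
  · set Z : Set X := ⋃ K ∈ s \ t, closure K with hZ
    have hZc : IsClosed Z := (hs.subset sdiff_subset).isClosed_biUnion fun _ _ => isClosed_closure
    have hxZ : (x : X) ∉ Z := by
      rw [hZ, mem_iUnion₂]
      rintro ⟨K, hK1, hK2⟩
      exact hK1.2 ⟨hK1.1, hK2⟩
    have : ((↑) : A → X) ⁻¹' Zᶜ ∈ 𝓝 x :=
      continuous_subtype_val.continuousAt.preimage_mem_nhds (hZc.isOpen_compl.mem_nhds hxZ)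
    filter_upwards [this] with y hy
    have hyA : (y : X) ∈ ⋃₀ s := hsA ▸ y.2
    obtain ⟨K, hKs, hyK⟩ := hyA
    refine mem_biUnion (x := K) ?_ (subset_closure hyK)
    by_contra hKt
    exact hy (mem_biUnion (x := K) ⟨hKs, hKt⟩ (subset_closure hyK))
  · rw [← Topology.IsInducing.subtypeVal.isPreconnected_image, Subtype.image_preimage_coe,
      inter_eq_self_of_subset_right hWA]
    exact hWc
  · intro y hy
    apply hrU
    obtain ⟨K, hKt, hyK⟩ := mem_iUnion₂.1 hy
    obtain ⟨-, z, hz⟩ := hK K hKt.1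
    have hz' := closure_minimal hz isClosed_closedBall
    have h1 : dist (y : X) z ≤ r / 3 := hz' hyK
    have h2 : dist (x : X) z ≤ r / 3 := hz' hKt.2
    have h3 := dist_triangle_right (y : X) x z
    rw [mem_ball, Subtype.dist_eq]
    linarith

/-! ### Connected sets in compact locally connected spaces -/

theorem exists_isOpen_isPreconnected_closure_subset {X : Type*} [TopologicalSpace X]
    [RegularSpace X] [LocallyConnectedSpace X] {O : Set X} (hO : IsOpen O) {x : X} (hx : x ∈ O) :
    ∃ W, IsOpen W ∧ IsPreconnected W ∧ x ∈ W ∧ closure W ⊆ O := by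
  obtain ⟨C, hC, hCc, hCO⟩ := exists_mem_nhds_isClosed_subset (hO.mem_nhds hx)
  have hxC : x ∈ interior C := mem_interior_iff_mem_nhds.2 hC
  exact ⟨connectedComponentIn (interior C) x, isOpen_interior.connectedComponentIn,
    isPreconnected_connectedComponentIn, mem_connectedComponentIn hxC,
    (closure_minimal ((connectedComponentIn_subset _ _).trans interior_subset) hCc).trans hCO⟩

/-- In a compact regular locally connected space, two points of a connected open set lie in a
subcontinuum of it. -/
theorem IsPreconnected.exists_isCompact_isPreconnected {X : Type*} [TopologicalSpace X]
    [CompactSpace X] [RegularSpace X] [LocallyConnectedSpace X] {O : Set X}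
    (hc : IsPreconnected O) (hO : IsOpen O) {x y : X} (hx : x ∈ O) (hy : y ∈ O) :
    ∃ K, IsCompact K ∧ IsPreconnected K ∧ K ⊆ O ∧ x ∈ K ∧ y ∈ K := by
  set S : Set X := {z | ∃ K, IsCompact K ∧ IsPreconnected K ∧ K ⊆ O ∧ x ∈ K ∧ z ∈ K} with hS
  -- The set `S` absorbs every small connected neighbourhood that it meets.
  have key : ∀ W, IsPreconnected W → closure W ⊆ O → (W ∩ S).Nonempty → W ⊆ S := by
    rintro W hW hWO ⟨w, hwW, K, h1, h2, h3, h4, h5⟩ z hz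
    exact ⟨K ∪ closure W, h1.union isClosed_closure.isCompact,
      h2.union w h5 (subset_closure hwW) hW.closure, union_subset h3 hWO, Or.inl h4,
      Or.inr (subset_closure hz)⟩
  have hxS : x ∈ S := ⟨{x}, isCompact_singleton, isPreconnected_singleton,
    singleton_subset_iff.2 hx, rfl, rfl⟩
  have hSO : S ⊆ O := fun z ⟨_, _, _, h, _, hz⟩ => h hz
  refine hc.subset_of_closure_inter_subset ?_ ⟨x, hx, hxS⟩ ?_ hy
  · rw [isOpen_iff_mem_nhds]
    intro z hz
    obtain ⟨W, hWo, hWc, hzW, hWO⟩ := exists_isOpen_isPreconnected_closure_subset hO (hSO hz)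
    exact Filter.mem_of_superset (hWo.mem_nhds hzW) (key W hWc hWO ⟨z, hzW, hz⟩)
  · rintro z ⟨hzS, hzO⟩
    obtain ⟨W, hWo, hWc, hzW, hWO⟩ := exists_isOpen_isPreconnected_closure_subset hO hzO
    exact key W hWc hWO (mem_closure_iff.1 hzS W hWo hzW) hzW

/-- Uniform local connectedness of a compact locally connected metric space. -/
theorem exists_ball_subset_isOpen_isPreconnected (X : Type*) [MetricSpace X] [CompactSpace X]
    [LocallyConnectedSpace X] {ε : ℝ} (hε : 0 < ε) :
    ∃ e > 0, ∀ x : X, ∃ V, IsOpen V ∧ IsPreconnected V ∧ ball x e ⊆ V ∧ V ⊆ ball x ε := by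
  choose W hWo hWc hzW hW using fun z : X => exists_isOpen_isPreconnected_closure_subset
    (isOpen_ball (x := z) (ε := ε / 2)) (mem_ball_self (half_pos hε))
  obtain ⟨e, he, h⟩ := lebesgue_number_lemma_of_metric (isCompact_univ (X := X)) hWo
    (fun z _ => mem_iUnion.2 ⟨z, hzW z⟩)
  refine ⟨e, he, fun x => ?_⟩
  obtain ⟨z, hz⟩ := h x (mem_univ x)
  refine ⟨W z, hWo z, hWc z, hz, fun y hy => ?_⟩
  have h1 : dist y z < ε / 2 := hW z (subset_closure hy)
  have h2 : dist x z < ε / 2 := hW z (subset_closure (hz (mem_ball_self he)))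
  have h3 := dist_triangle_right y x z
  rw [mem_ball]
  linarith

/-- Boundary bumping: in a connected open set `V` that meets the closed set `E`, the component of
`V \ E` at a point accumulates at some point of `E ∩ V`. -/
theorem exists_mem_closure_connectedComponentIn_diff {X : Type*} [TopologicalSpace X]
    [LocallyConnectedSpace X] {V E : Set X} (hVo : IsOpen V) (hV : IsPreconnected V)
    (hE : IsClosed E) (hVE : (V ∩ E).Nonempty) {x : X} (hxV : x ∈ V) (hxE : x ∉ E) :
    ∃ y ∈ closure (connectedComponentIn (V \ E) x), y ∈ V ∧ y ∈ E := by
  by_contra! hcon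
  set C := connectedComponentIn (V \ E) x with hC
  have hCs : C ⊆ V \ E := connectedComponentIn_subset _ _
  have hxC : x ∈ C := mem_connectedComponentIn ⟨hxV, hxE⟩
  have h1 : closure C ∩ V ⊆ C := by
    refine IsPreconnected.subset_connectedComponentIn ?_ ⟨subset_closure hxC, hxV⟩
      fun z hz => ⟨hz.2, hcon z hz.1 hz.2⟩
    exact isPreconnected_connectedComponentIn.subset_closure
      (subset_inter subset_closure (hCs.trans sdiff_subset)) inter_subset_left
  have h2 : V ⊆ C := hV.subset_of_closure_inter_subset (hVo.sdiff hE).connectedComponentIn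
    ⟨x, hxV, hxC⟩ h1
  obtain ⟨t, htV, htE⟩ := hVE
  exact (hCs (h2 htV)).2 htE

/-! ### Absorbing points with controlled attachments -/

/-- A family of compact sets `E i j` that enlarges the compact sets `D i`: the pieces with distinct
first index are disjoint, the part `E i j` stays in the ball of radius `ρ` about `c j`, and each of
its points is joined to `D i` inside `E i j`.

The second index is what keeps the attaching connected sets small: a point absorbed by
`E i j` is never joined to `D i` through another part of the same piece. -/
structure IsAttachedFamily {X ι κ : Type*} [MetricSpace X] (D : ι → Set X) (c : κ → X) (ρ : ℝ)
    (E : ι → κ → Set X) : Prop where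
  isCompact : ∀ i j, IsCompact (E i j)
  disjoint : ∀ i i' j j', i ≠ i' → Disjoint (E i j) (E i' j')
  subset_ball : ∀ i j, E i j ⊆ ball (c j) ρ
  subset_iUnion : ∀ i, D i ⊆ ⋃ j, E i j
  attached : ∀ i j, ∀ y ∈ E i j, ∃ K ⊆ E i j, IsPreconnected K ∧ y ∈ K ∧ (K ∩ D i).Nonempty

namespace IsAttachedFamily

variable {X ι κ : Type*} [MetricSpace X] {D : ι → Set X} {c : κ → X} {ρ : ℝ}
  {E : ι → κ → Set X}

theorem mono_radius {ρ' : ℝ} (h : IsAttachedFamily D c ρ E) (hρ : ρ ≤ ρ') :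
    IsAttachedFamily D c ρ' E :=
  { h with subset_ball := fun i j => (h.subset_ball i j).trans (ball_subset_ball hρ) }

theorem isClosed_iUnion [Finite ι] [Finite κ] (h : IsAttachedFamily D c ρ E) :
    IsClosed (⋃ i, ⋃ j, E i j) :=
  isClosed_iUnion_of_finite fun i => isClosed_iUnion_of_finite fun j => (h.isCompact i j).isClosed

/-- Given a small connected open neighbourhood `V` of `x` that meets the pieces, either `x` can be
absorbed by some part without leaving the balls, or `V` sits across the boundary sphere of one
of the balls. -/
theorem exists_absorb_or [Finite ι] [Finite κ] [CompactSpace X] [LocallyConnectedSpace X]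
    (h : IsAttachedFamily D c ρ E) {V : Set X} (hVo : IsOpen V) (hV : IsPreconnected V)
    (hVD : ∃ i, (V ∩ D i).Nonempty) {x : X} (hxV : x ∈ V) (hxE : x ∉ ⋃ i, ⋃ j, E i j) :
    (∃ E', IsAttachedFamily D c ρ E' ∧ (∀ i j, E i j ⊆ E' i j) ∧ x ∈ ⋃ i, ⋃ j, E' i j) ∨
      ∃ j, (V ∩ ball (c j) ρ).Nonempty ∧ ¬ V ⊆ ball (c j) ρ := by
  classical
  have hVE : (V ∩ ⋃ i, ⋃ j, E i j).Nonempty := by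
    obtain ⟨i, z, hzV, hzD⟩ := hVD
    exact ⟨z, hzV, mem_iUnion.2 ⟨i, h.subset_iUnion i hzD⟩⟩
  obtain ⟨y, hyC, hyV, hyE⟩ :=
    exists_mem_closure_connectedComponentIn_diff hVo hV h.isClosed_iUnion hVE hxV hxE
  set C := connectedComponentIn (V \ ⋃ i, ⋃ j, E i j) x with hC
  have hCs : C ⊆ V \ ⋃ i, ⋃ j, E i j := connectedComponentIn_subset _ _
  have hxC : x ∈ C := mem_connectedComponentIn ⟨hxV, hxE⟩
  have hCo : IsOpen C := (hVo.sdiff h.isClosed_iUnion).connectedComponentIn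
  obtain ⟨i, hyi⟩ := mem_iUnion.1 hyE
  obtain ⟨j, hyij⟩ := mem_iUnion.1 hyi
  by_cases hVj : V ⊆ ball (c j) ρ
  swap
  · exact Or.inr ⟨j, ⟨y, hyV, h.subset_ball i j hyij⟩, hVj⟩
  left
  -- The other pieces are at positive distance from `y`, so a neighbourhood `N` of `y` joins the
  -- component `C` to `E i j` without meeting them.
  set Z : Set X := ⋃ p : {i' // i' ≠ i} × κ, E p.1 p.2 with hZ
  have hZc : IsClosed Z := isClosed_iUnion_of_finite fun p => (h.isCompact _ _).isClosed
  have hyZ : y ∉ Z := by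
    rw [hZ, mem_iUnion]
    rintro ⟨p, hp⟩
    exact disjoint_left.1 (h.disjoint _ _ _ _ p.1.2) hp hyij
  obtain ⟨N, hNo, hNc, hyN, hN⟩ :=
    exists_isOpen_isPreconnected_closure_subset (hVo.sdiff hZc) ⟨hyV, hyZ⟩
  replace hN := subset_closure.trans hN
  obtain ⟨w, hwN, hwC⟩ := mem_closure_iff.1 hyC N hNo hyN
  have hCN : IsPreconnected (C ∪ N) :=
    isPreconnected_connectedComponentIn.union w hwC hwN hNc
  obtain ⟨K, hKc, hKp, hKs, hxK, hyK⟩ :=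
    hCN.exists_isCompact_isPreconnected (hCo.union hNo) (Or.inl hxC) (Or.inr hyN)
  have hKV : K ⊆ V := hKs.trans (union_subset (hCs.trans sdiff_subset) (hN.trans sdiff_subset))
  have hKd : ∀ i' j', i' ≠ i → Disjoint K (E i' j') := by
    intro i' j' hi'
    refine disjoint_left.2 fun z hz hzE => ?_
    rcases hKs hz with hz | hz
    · exact (hCs hz).2 (mem_iUnion.2 ⟨i', mem_iUnion.2 ⟨j', hzE⟩⟩)
    · exact (hN hz).2 (mem_iUnion.2 ⟨(⟨i', hi'⟩, j'), hzE⟩)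
  set L : ι → κ → Set X := fun i' j' => if i' = i ∧ j' = j then K else ∅ with hL
  have hLij : L i j = K := if_pos ⟨rfl, rfl⟩
  have hLd : ∀ i₁ i₂ j₁ j₂, i₁ ≠ i₂ → Disjoint (L i₁ j₁) (E i₂ j₂) := by
    intro i₁ i₂ j₁ j₂ hi
    by_cases h1 : i₁ = i ∧ j₁ = j
    · rw [hL]; simp only [h1, and_self, if_true]
      exact hKd _ _ (h1.1 ▸ hi.symm)
    · rw [hL]; simp only [h1, if_false]
      exact empty_disjoint _
  refine ⟨fun i' j' => E i' j' ∪ L i' j', ⟨?_, ?_, ?_, ?_, ?_⟩, fun i' j' => subset_union_left, ?_⟩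
  · intro i' j'
    refine (h.isCompact i' j').union ?_
    by_cases h1 : i' = i ∧ j' = j
    · rw [h1.1, h1.2, hLij]; exact hKc
    · rw [hL]; simp only [h1, if_false]; exact isCompact_empty
  · intro i₁ i₂ j₁ j₂ hi
    refine disjoint_union_left.2 ⟨disjoint_union_right.2 ⟨h.disjoint _ _ _ _ hi,
      (hLd _ _ _ _ hi.symm).symm⟩, disjoint_union_right.2 ⟨hLd _ _ _ _ hi, ?_⟩⟩
    by_cases h1 : i₁ = i ∧ j₁ = j
    · have h2 : ¬ (i₂ = i ∧ j₂ = j) := fun h2 => hi (h1.1.trans h2.1.symm)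
      rw [hL]; simp only [h2, if_false]; exact disjoint_empty _
    · rw [hL]; simp only [h1, if_false]; exact empty_disjoint _
  · intro i' j'
    refine union_subset (h.subset_ball i' j') ?_
    by_cases h1 : i' = i ∧ j' = j
    · rw [h1.1, h1.2, hLij]; exact hKV.trans hVj
    · rw [hL]; simp only [h1, if_false]; exact empty_subset _
  · exact fun i' => (h.subset_iUnion i').trans (iUnion_mono fun j' => subset_union_left)
  · rintro i' j' z (hz | hz)
    · obtain ⟨M, hM, hM2⟩ := h.attached i' j' z hz
      exact ⟨M, hM.trans subset_union_left, hM2⟩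
    · by_cases h1 : i' = i ∧ j' = j
      · obtain ⟨rfl, rfl⟩ := h1
        rw [hLij] at hz ⊢
        obtain ⟨M, hM, hMc, hyM, hMD⟩ := h.attached i' j' y hyij
        exact ⟨M ∪ K, union_subset_union hM subset_rfl, hMc.union y hyM hyK hKp, Or.inr hz,
          hMD.mono (inter_subset_inter_left _ subset_union_left)⟩
      · rw [hL] at hz; simp only [h1, if_false] at hz; exact hz.elim
  · exact mem_iUnion.2 ⟨i, mem_iUnion.2 ⟨j, Or.inr (hLij ▸ hxK)⟩⟩

/-- Absorbing points of the finite set `P` as long as possible, for a fixed radius. -/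
theorem exists_saturated [Finite ι] [Finite κ] [CompactSpace X] [LocallyConnectedSpace X]
    (h : IsAttachedFamily D c ρ E) {V : X → Set X} (hVo : ∀ x, IsOpen (V x))
    (hV : ∀ x, IsPreconnected (V x)) (hVD : ∀ x, ∃ i, (V x ∩ D i).Nonempty)
    (hxV : ∀ x, x ∈ V x) {P : Set X} (hP : P.Finite) :
    ∃ E', IsAttachedFamily D c ρ E' ∧ (∀ i j, E i j ⊆ E' i j) ∧
      ∀ x ∈ P \ ⋃ i, ⋃ j, E' i j, ∃ j, (V x ∩ ball (c j) ρ).Nonempty ∧ ¬ V x ⊆ ball (c j) ρ := by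
  induction hn : (P \ ⋃ i, ⋃ j, E i j).ncard using Nat.strong_induction_on generalizing E with
  | _ n ih =>
    by_cases hsat : ∀ x ∈ P \ ⋃ i, ⋃ j, E i j,
        ∃ j, (V x ∩ ball (c j) ρ).Nonempty ∧ ¬ V x ⊆ ball (c j) ρ
    · exact ⟨E, h, fun _ _ => subset_rfl, hsat⟩
    push Not at hsat
    obtain ⟨x, ⟨hxP, hxE⟩, hx⟩ := hsat
    obtain ⟨E', hE', hEE', hxE'⟩ | ⟨j, hj1, hj2⟩ :=
      h.exists_absorb_or (hVo x) (hV x) (hVD x) (hxV x) hxE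
    · have hlt : (P \ ⋃ i, ⋃ j, E' i j).ncard < n := by
        rw [← hn]
        refine ncard_lt_ncard ⟨sdiff_subset_sdiff_right (iUnion₂_mono hEE'), fun hsub => ?_⟩ hP.sdiff
        exact (hsub ⟨hxP, hxE⟩).2 hxE'
      obtain ⟨E'', h1, h2, h3⟩ := ih _ hlt hE' rfl
      exact ⟨E'', h1, fun i j => (hEE' i j).trans (h2 i j), h3⟩
    · exact absurd (hx j hj1) hj2

/-- All points of a finite set can be absorbed, at the cost of increasing the radius by `2 * ε`
once for each ball. A point that cannot be absorbed at a given radius lies near the boundary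
sphere of some ball; it is deep inside this ball for all later radii, so that each ball obstructs
the point at most once. -/
theorem exists_subset_iUnion [Finite ι] [Finite κ] [CompactSpace X] [LocallyConnectedSpace X]
    (h : IsAttachedFamily D c ρ E) {V : X → Set X} (hVo : ∀ x, IsOpen (V x))
    (hV : ∀ x, IsPreconnected (V x)) (hVD : ∀ x, ∃ i, (V x ∩ D i).Nonempty)
    (hxV : ∀ x, x ∈ V x) {ε : ℝ} (hε : 0 < ε) (hVε : ∀ x, V x ⊆ ball x ε)
    {P : Set X} (hP : P.Finite) :
    ∃ E', IsAttachedFamily D c (ρ + 2 * ε * (Nat.card κ + 1)) E' ∧ P ⊆ ⋃ i, ⋃ j, E' i j := by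
  have key : ∀ m : ℕ, ∃ E', IsAttachedFamily D c (ρ + 2 * ε * m) E' ∧
      ∀ x ∈ P \ ⋃ i, ⋃ j, E' i j, m ≤ {j | V x ⊆ ball (c j) (ρ + 2 * ε * (m + 1))}.ncard := by
    intro m
    induction m with
    | zero => exact ⟨E, by simpa using h, fun _ _ => Nat.zero_le _⟩
    | succ m ih =>
      obtain ⟨E₁, hE₁, hcard⟩ := ih
      obtain ⟨E₂, hE₂, hsub, hsat⟩ := (hE₁.mono_radius
        (by push_cast; linarith : ρ + 2 * ε * m ≤ ρ + 2 * ε * (m + 1 : ℕ))).exists_saturated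
          hVo hV hVD hxV hP
      push_cast at hE₂ hsat ⊢
      refine ⟨E₂, hE₂, fun x hx => ?_⟩
      obtain ⟨j, ⟨z, hzV, hzj⟩, hj⟩ := hsat x hx
      refine lt_of_le_of_lt (hcard x ⟨hx.1, fun hx' => hx.2 (iUnion₂_mono hsub hx')⟩)
        (ncard_lt_ncard ⟨fun j' hj' => ?_, fun hcon => hj (hcon (a := j) fun y hy => ?_)⟩
          (toFinite _))
      · exact subset_trans hj' (ball_subset_ball (by linarith))
      · have h1 := mem_ball.1 (hVε x hy)
        have h2 := mem_ball.1 (hVε x hzV)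
        have h3 := dist_triangle_right y z x
        have h4 := dist_triangle y z (c j)
        rw [mem_ball] at hzj ⊢
        linarith
  obtain ⟨E', hE', hcard⟩ := key (Nat.card κ + 1)
  refine ⟨E', by exact_mod_cast hE', fun x hx => ?_⟩
  by_contra hxE
  have h1 := hcard x ⟨hx, hxE⟩
  have h2 := ncard_le_card {j | V x ⊆ ball (c j) (ρ + 2 * ε * ((Nat.card κ + 1 : ℕ) + 1))}
  omega

end IsAttachedFamily

/-! ### The growth process -/

/-- Finitely many disjoint compact sets have disjoint compact neighbourhoods all of whose points
are joined to the given sets by arbitrarily small connected sets. -/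
theorem exists_thickening_isPreconnected {X ι : Type*} [MetricSpace X] [CompactSpace X]
    [LocallyConnectedSpace X] [Finite ι] {D : ι → Set X} (hD : ∀ i, IsCompact (D i))
    (hd : Pairwise (Function.onFun Disjoint D)) {a : ℝ} (ha : 0 < a) :
    ∃ D' : ι → Set X, (∀ i, IsCompact (D' i)) ∧ Pairwise (Function.onFun Disjoint D') ∧
      (∀ i, D i ⊆ interior (D' i)) ∧
      ∀ i, ∀ y ∈ D' i, ∃ z ∈ D i, ∃ K ⊆ D' i, IsPreconnected K ∧ y ∈ K ∧ z ∈ K ∧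
        K ⊆ closedBall z a := by
  classical
  obtain ⟨O, hO, hDO, hOd⟩ : ∃ O : ι → Set X, (∀ i, IsOpen (O i)) ∧ (∀ i, D i ⊆ O i) ∧
      Pairwise (Function.onFun Disjoint O) := by
    have hsep : ∀ i, SeparatedNhds (D i) (⋃ i' : {i' // i' ≠ i}, D i') := fun i =>
      SeparatedNhds.of_isCompact_isCompact (hD i) (isCompact_iUnion fun i' => hD i')
        (disjoint_iUnion_right.2 fun i' => hd i'.2.symm)
    choose A B hA hB hDA hDB hAB using hsep
    refine ⟨fun i => A i ∩ ⋂ i' : {i' // i' ≠ i}, B i', fun i => (hA i).inter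
      (isOpen_iInter_of_finite fun i' => hB i'), fun i => subset_inter (hDA i)
      (subset_iInter fun i' => ?_), fun i i' hi => ?_⟩
    · exact (subset_iUnion (fun k : {k // k ≠ (i' : ι)} => D k) ⟨i, i'.2.symm⟩).trans (hDB i')
    · exact (hAB i).mono inter_subset_left
        (inter_subset_right.trans (iInter_subset (fun k : {k // k ≠ i'} => B k) ⟨i, hi⟩))
  choose! W hWo hWc hyW hW using fun i y (hy : y ∈ D i) =>
    exists_isOpen_isPreconnected_closure_subset ((hO i).inter (isOpen_ball (x := y) (ε := a)))
      ⟨hDO i hy, mem_ball_self ha⟩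
  choose t htD hcov using fun i => (hD i).elim_nhds_subcover (W i)
    fun y hy => (hWo i y hy).mem_nhds (hyW i y hy)
  refine ⟨fun i => ⋃ y ∈ t i, closure (W i y), fun i => ?_, fun i i' hi => ?_, fun i => ?_,
    fun i y hy => ?_⟩
  · exact (t i).isCompact_biUnion fun y _ => isClosed_closure.isCompact
  · refine (hOd hi).mono ?_ ?_ <;>
      exact iUnion₂_subset fun y hy => (hW _ y (htD _ y hy)).trans inter_subset_left
  · refine (hcov i).trans (interior_maximal ?_ ?_)
    · exact iUnion₂_mono fun y _ => subset_closure
    · exact isOpen_biUnion fun y hy => hWo i y (htD i y hy)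
  · obtain ⟨z, hz, hyz⟩ := mem_iUnion₂.1 hy
    have hzD := htD i z hz
    exact ⟨z, hzD, closure (W i z), subset_iUnion₂ (s := fun y _ => closure (W i y)) z hz,
      (hWc i z hzD).closure, hyz, subset_closure (hyW i z hzD),
      ((hW i z hzD).trans inter_subset_right).trans ball_subset_closedBall⟩

/-- One step of the growth process. If the disjoint compact sets `D i` are sufficiently dense,
depending only on `a`, they can be enlarged to disjoint compact sets that are as dense as desired,
each point of an enlarged set being joined to the original set within distance `a`. -/
theorem exists_enlargement (X : Type*) [MetricSpace X] [CompactSpace X]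
    [LocallyConnectedSpace X] {a : ℝ} (ha : 0 < a) :
    ∃ e > 0, ∀ {ι : Type*} [Finite ι] (D : ι → Set X), (∀ i, IsCompact (D i)) →
      Pairwise (Function.onFun Disjoint D) → (∀ x, ∃ i, ∃ y ∈ D i, dist y x < e) →
      ∀ β > 0, ∃ D' : ι → Set X, (∀ i, IsCompact (D' i)) ∧ Pairwise (Function.onFun Disjoint D') ∧
        (∀ x, ∃ i, ∃ y ∈ D' i, dist y x < β) ∧ (∀ i, D i ⊆ interior (D' i)) ∧
        ∀ i, ∀ y ∈ D' i, ∃ K ⊆ D' i, IsPreconnected K ∧ y ∈ K ∧ (K ∩ D i).Nonempty ∧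
          K ⊆ closedBall y a := by
  set δ := a / 6 with hδ
  have hδ0 : 0 < δ := by positivity
  obtain ⟨C, -, hCfin, hC⟩ := finite_cover_balls_of_compact (isCompact_univ (X := X)) hδ0
  have := hCfin.to_subtype
  -- Absorption may take one round per ball, so `ε` is chosen small against their number.
  set N : ℝ := (Nat.card C : ℝ) with hN
  have hN0 : 0 ≤ N := Nat.cast_nonneg _
  set ε := δ / (4 * (N + 1)) with hε
  have hε0 : 0 < ε := by positivity
  obtain ⟨e, he, hV⟩ := exists_ball_subset_isOpen_isPreconnected X hε0
  choose V hVo hVc hVe hVε using hV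
  refine ⟨e, he, fun D hD hd hdense β hβ => ?_⟩
  obtain ⟨P, -, hPfin, hP⟩ := finite_cover_balls_of_compact (isCompact_univ (X := X)) hβ
  have h0 : IsAttachedFamily D (fun c : C => (c : X)) (δ + δ / 2)
      fun i c => D i ∩ closedBall (c : X) δ := by
    refine ⟨fun i c => (hD i).inter_right isClosed_closedBall, fun i i' c c' hi =>
      (hd hi).mono inter_subset_left inter_subset_left, fun i c =>
      inter_subset_right.trans (closedBall_subset_ball (by linarith)), fun i y hy => ?_,
      fun i c y hy => ⟨{y}, singleton_subset_iff.2 hy, isPreconnected_singleton, rfl, y, rfl, hy.1⟩⟩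
    obtain ⟨c, hc, hyc⟩ := mem_iUnion₂.1 (hC (mem_univ y))
    exact mem_iUnion.2 ⟨⟨c, hc⟩, hy, ball_subset_closedBall hyc⟩
  obtain ⟨E, hE, hPE⟩ := h0.exists_subset_iUnion hVo hVc
    (fun x => (hdense x).imp fun i ⟨y, hy, hyx⟩ => ⟨y, hVe x hyx, hy⟩)
    (fun x => hVe x (mem_ball_self he)) hε0 hVε hPfin
  have hρ : δ + δ / 2 + 2 * ε * (Nat.card C + 1) = 2 * δ := by
    rw [← hN, hε]; field_simp; ring
  rw [hρ] at hE
  have hEc : ∀ i, IsCompact (⋃ c, E i c) := fun i => isCompact_iUnion fun c => hE.isCompact i c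
  obtain ⟨D', hD', hd', hED', hatt⟩ := exists_thickening_isPreconnected hEc
    (fun i i' hi => disjoint_iUnion_left.2 fun c => disjoint_iUnion_right.2 fun c' =>
      hE.disjoint i i' c c' hi) hδ0
  refine ⟨D', hD', hd', fun x => ?_, fun i => (hE.subset_iUnion i).trans (hED' i), ?_⟩
  · obtain ⟨p, hp, hxp⟩ := mem_iUnion₂.1 (hP (mem_univ x))
    obtain ⟨i, hi⟩ := mem_iUnion.1 (hPE hp)
    exact ⟨i, p, interior_subset (hED' i hi), mem_ball'.1 hxp⟩
  · intro i y hy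
    obtain ⟨z, hz, K, hK, hKc, hyK, hzK, hKa⟩ := hatt i y hy
    obtain ⟨c, hc⟩ := mem_iUnion.1 hz
    obtain ⟨L, hL, hLc, hzL, hLD⟩ := hE.attached i c z hc
    refine ⟨K ∪ L, union_subset hK ((hL.trans (subset_iUnion _ c)).trans
      ((hED' i).trans interior_subset)), hKc.union z hzK hzL hLc, Or.inl hyK,
      hLD.mono (inter_subset_inter_left _ subset_union_right), ?_⟩
    have hyz : dist y z ≤ δ := hKa hyK
    have hzc : dist z c < 2 * δ := hE.subset_ball i c hc
    rintro w (hw | hw)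
    · have hwz : dist w z ≤ δ := hKa hw
      have := dist_triangle_right w y z
      rw [mem_closedBall]; linarith
    · have hwc : dist w c < 2 * δ := hE.subset_ball i c (hL hw)
      have h1 := dist_triangle_right w z c
      have h2 := dist_triangle_right w y z
      rw [mem_closedBall]; linarith

/-! ### Partition into Peano continua -/

/-- A compact locally connected metric space contains finitely many disjoint open connected sets
with property S of small diameter whose union is dense. -/
theorem exists_dense_partition_hasPropertyS (X : Type*) [MetricSpace X] [CompactSpace X]
    [LocallyConnectedSpace X] {η : ℝ} (hη : 0 < η) :
    ∃ (P : Set X) (U : P → Set X), P.Finite ∧ (∀ p, IsOpen (U p)) ∧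
      Pairwise (Function.onFun Disjoint U) ∧ (∀ p, IsConnected (U p)) ∧
      (∀ p, HasPropertyS (U p)) ∧ (∀ p, U p ⊆ closedBall p η) ∧ closure (⋃ p, U p) = univ := by
  choose! e he henl using fun (a : ℝ) (ha : 0 < a) => exists_enlargement X ha
  set a : ℕ → ℝ := fun k => η / 2 ^ (k + 1) with ha
  have ha0 : ∀ k, 0 < a k := fun k => by positivity
  -- The density required at stage `k`.
  set b : ℕ → ℝ := fun k => min (e (a k)) (a k) with hb
  have hb0 : ∀ k, 0 < b k := fun k => lt_min (he _ (ha0 k)) (ha0 k)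
  obtain ⟨P, -, hPfin, hP⟩ := finite_cover_balls_of_compact (isCompact_univ (X := X)) (hb0 0)
  have := hPfin.to_subtype
  let Good : ℕ → (P → Set X) → Prop := fun k D => (∀ p, IsCompact (D p)) ∧
    Pairwise (Function.onFun Disjoint D) ∧ ∀ x, ∃ p, ∃ y ∈ D p, dist y x < b k
  have step : ∀ k D, Good k D → ∃ D', Good (k + 1) D' ∧ (∀ p, D p ⊆ interior (D' p)) ∧
      ∀ p, ∀ y ∈ D' p, ∃ K ⊆ D' p, IsPreconnected K ∧ y ∈ K ∧ (K ∩ D p).Nonempty ∧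
          K ⊆ closedBall y (a k) := by
    rintro k D ⟨h1, h2, h3⟩
    obtain ⟨D', g1, g2, g3, g4, g5⟩ := henl (a k) (ha0 k) D h1 h2
      (fun x => (h3 x).imp fun p ⟨y, hy, hyx⟩ => ⟨y, hy, hyx.trans_le (min_le_left _ _)⟩)
      (b (k + 1)) (hb0 _)
    exact ⟨D', ⟨g1, g2, g3⟩, g4, g5⟩
  choose! f hf hfint hfatt using step
  let D : ℕ → P → Set X := fun k => Nat.rec (fun p => {(p : X)}) f k
  have hgood : ∀ k, Good k (D k) := by
    intro k
    induction k with
    | zero =>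
      refine ⟨fun p => isCompact_singleton, fun p q hpq =>
        disjoint_singleton.2 (Subtype.coe_injective.ne hpq), fun x => ?_⟩
      obtain ⟨p, hp, hxp⟩ := mem_iUnion₂.1 (hP (mem_univ x))
      exact ⟨⟨p, hp⟩, p, rfl, mem_ball'.1 hxp⟩
    | succ k ih => exact hf k _ ih
  have hint : ∀ k p, D k p ⊆ interior (D (k + 1) p) := fun k => hfint k _ (hgood k)
  have hatt : ∀ k p, ∀ y ∈ D (k + 1) p, ∃ K ⊆ D (k + 1) p, IsPreconnected K ∧ y ∈ K ∧
      (K ∩ D k p).Nonempty ∧ K ⊆ closedBall y (a k) := fun k => hfatt k _ (hgood k)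
  have hmono : ∀ p, Monotone fun k => D k p := fun p =>
    monotone_nat_of_le_succ fun k => (hint k p).trans interior_subset
  set U : P → Set X := fun p => ⋃ k, D k p with hU
  have hDU : ∀ k p, D k p ⊆ U p := fun k p => subset_iUnion (fun k => D k p) k
  have hUo : ∀ p, IsOpen (U p) := by
    intro p
    refine isOpen_iff_mem_nhds.2 fun x hx => ?_
    obtain ⟨k, hk⟩ := mem_iUnion.1 hx
    exact Filter.mem_of_superset (mem_interior_iff_mem_nhds.1 (hint k p hk)) (hDU (k + 1) p)
  -- Points of `U p` are joined to stage `k` within the sum of the later distances.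
  have htail : ∀ p k, ∀ x ∈ U p, ∃ L ⊆ U p, IsPreconnected L ∧ x ∈ L ∧ (L ∩ D k p).Nonempty ∧
      L ⊆ closedBall x (η / 2 ^ k) := by
    intro p k
    have aux : ∀ m, ∀ x ∈ D (k + m) p, ∃ L ⊆ U p, IsPreconnected L ∧ x ∈ L ∧
        (L ∩ D k p).Nonempty ∧ L ⊆ closedBall x (η / 2 ^ k - η / 2 ^ (k + m)) := by
      intro m
      induction m with
      | zero =>
        intro x hx
        exact ⟨{x}, singleton_subset_iff.2 (hDU _ _ hx), isPreconnected_singleton, rfl,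
          ⟨x, rfl, hx⟩, by simp⟩
      | succ m ih =>
        intro x hx
        obtain ⟨K, hK, hKc, hxK, ⟨z, hzK, hz⟩, hKx⟩ := hatt (k + m) p x hx
        obtain ⟨L, hL, hLc, hzL, hLD, hLz⟩ := ih z hz
        refine ⟨K ∪ L, union_subset (hK.trans (hDU (k + m + 1) p)) hL, hKc.union z hzK hzL hLc, Or.inl hxK,
          hLD.mono (inter_subset_inter_left _ subset_union_right), ?_⟩
        have hsum : η / 2 ^ k - η / 2 ^ (k + m) + a (k + m) = η / 2 ^ k - η / 2 ^ (k + (m + 1)) := by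
          simp only [ha, ← add_assoc, pow_succ]; field_simp; ring
        have hzx : dist z x ≤ a (k + m) := hKx hzK
        refine union_subset (hKx.trans (closedBall_subset_closedBall ?_)) (hLz.trans
          (closedBall_subset_closedBall' (by linarith)))
        have : η / 2 ^ (k + m) ≤ η / 2 ^ k :=
          div_le_div_of_nonneg_left hη.le (by positivity)
            (pow_le_pow_right₀ one_le_two (Nat.le_add_right k m))
        linarith
    intro x hx
    obtain ⟨l, hl⟩ := mem_iUnion.1 hx
    obtain ⟨L, h1, h2, h3, h4, h5⟩ := aux l x (hmono p (Nat.le_add_left l k) hl)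
    exact ⟨L, h1, h2, h3, h4, h5.trans (closedBall_subset_closedBall
      (sub_le_self _ (by positivity)))⟩
  have hpU : ∀ p, (p : X) ∈ U p := fun p => hDU 0 p rfl
  have hseed : ∀ p, ∀ x ∈ U p, ∃ L ⊆ U p, IsPreconnected L ∧ x ∈ L ∧ (p : X) ∈ L ∧
      L ⊆ closedBall x η := by
    intro p x hx
    obtain ⟨L, h1, h2, h3, ⟨z, hzL, hz⟩, h5⟩ := htail p 0 x hx
    obtain rfl : z = p := hz
    exact ⟨L, h1, h2, h3, hzL, by simpa using h5⟩
  refine ⟨P, U, hPfin, hUo, fun p q hpq => ?_, fun p => ⟨⟨p, hpU p⟩, ?_⟩, fun p => ?_,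
    fun p x hx => ?_, ?_⟩
  · refine disjoint_left.2 fun x hxp hxq => ?_
    obtain ⟨k, hk⟩ := mem_iUnion.1 hxp
    obtain ⟨l, hl⟩ := mem_iUnion.1 hxq
    exact disjoint_left.1 ((hgood (max k l)).2.1 hpq) (hmono p (le_max_left k l) hk)
      (hmono q (le_max_right k l) hl)
  · refine isPreconnected_of_forall (p : X) fun x hx => ?_
    obtain ⟨L, h1, h2, h3, h4, -⟩ := hseed p x hx
    exact ⟨L, h1, h4, h3, h2⟩
  · intro r hr
    obtain ⟨k, hk⟩ : ∃ k : ℕ, η / 2 ^ k ≤ r / 3 := by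
      obtain ⟨k, hk⟩ := pow_unbounded_of_one_lt (η / (r / 3)) one_lt_two
      exact ⟨k, by rw [div_le_comm₀ (by positivity) (by positivity)]; exact hk.le⟩
    choose! W hWo hWc hyW hW using fun y (hy : y ∈ D k p) =>
      exists_isOpen_isPreconnected_closure_subset ((hUo p).inter (isOpen_ball (x := y) (ε := r / 3)))
        ⟨hDU k p hy, mem_ball_self (by positivity)⟩
    obtain ⟨t, htD, hcov⟩ := ((hgood k).1 p).elim_nhds_subcover W
      fun y hy => (hWo y hy).mem_nhds (hyW y hy)
    choose! L hLU hLc hxL hLD hLx using htail p k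
    -- Each member of a finite cover of stage `k`, together with all that is attached to it.
    let M : X → Set X := fun y => ⋃ x ∈ {x ∈ U p | (L x ∩ W y).Nonempty}, (W y ∪ L x)
    have hWU : ∀ y ∈ t, W y ⊆ U p := fun y hy =>
      subset_closure.trans ((hW y (htD y hy)).trans inter_subset_left)
    have hWr : ∀ y ∈ t, W y ⊆ ball y (r / 3) := fun y hy =>
      subset_closure.trans ((hW y (htD y hy)).trans inter_subset_right)
    refine ⟨M '' t, t.finite_toSet.image _, Subset.antisymm ?_ fun x hx => ?_, ?_⟩
    · rw [sUnion_image]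
      exact iUnion₂_subset fun y hy => iUnion₂_subset fun x hx =>
        union_subset (hWU y hy) (hLU x hx.1)
    · obtain ⟨z, hzL, hzD⟩ := hLD x hx
      obtain ⟨y, hy, hzy⟩ := mem_iUnion₂.1 (hcov hzD)
      exact ⟨M y, mem_image_of_mem _ hy,
        mem_biUnion (x := x) ⟨hx, z, hzL, hzy⟩ (Or.inr (hxL x hx))⟩
    · rintro _ ⟨y, hy, rfl⟩
      have hyD := htD y hy
      refine ⟨?_, y, iUnion₂_subset ?_⟩
      · change IsPreconnected (⋃ x ∈ {x ∈ U p | (L x ∩ W y).Nonempty}, (W y ∪ L x))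
        rw [← sUnion_image]
        refine isPreconnected_sUnion y _ ?_ ?_
        · rintro _ ⟨x, -, rfl⟩; exact Or.inl (hyW y hyD)
        · rintro _ ⟨x, ⟨hx, z, hzL, hzW⟩, rfl⟩
          exact (hWc y hyD).union z hzW hzL (hLc x hx)
      · rintro x ⟨hx, z, hzL, hzW⟩ w (hw | hw)
        · exact ball_subset_closedBall (ball_subset_ball (by linarith) (hWr y hy hw))
        · have h1 : dist w x ≤ r / 3 := (hLx x hx hw).trans hk
          have h2 : dist z x ≤ r / 3 := (hLx x hx hzL).trans hk
          have h3 : dist z y < r / 3 := hWr y hy hzW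
          have h4 := dist_triangle_right w z x
          have h5 := dist_triangle w z y
          rw [mem_closedBall]; linarith
  · obtain ⟨L, -, -, -, h4, h5⟩ := hseed p x hx
    exact mem_closedBall_comm.1 (h5 h4)
  · refine eq_univ_of_forall fun x => Metric.mem_closure_iff.2 fun r hr => ?_
    obtain ⟨k, hk⟩ := pow_unbounded_of_one_lt (η / r) one_lt_two
    obtain ⟨p, y, hy, hyx⟩ := (hgood k).2.2 x
    refine ⟨y, mem_iUnion.2 ⟨p, hDU k p hy⟩, ?_⟩
    rw [dist_comm]
    refine hyx.trans ((min_le_right _ _).trans_lt ?_)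
    rw [ha, div_lt_comm₀ (by positivity) hr]
    exact hk.trans (pow_lt_pow_right₀ one_lt_two (Nat.lt_succ_self k))

theorem mainTheorem8 {X : Type*} [MetricSpace X] (hX : IsPeanoContinuum X)
    (ε : ℝ) (hε : 0 < ε) :
    ∃ F : Set (Set X), F.Finite ∧ ⋃₀ F = Set.univ ∧
      (∀ A ∈ F, IsPeanoContinuum A) ∧
      mesh F ≤ ENNReal.ofReal ε ∧
      (∀ A ∈ F, (interior A).Nonempty) ∧
      F.PairwiseDisjoint interior := by
  have := hX.compact
  have := hX.locallyConnected
  obtain ⟨P, U, hP, hUo, hd, hUc, hUS, hUη, hdense⟩ :=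
    exists_dense_partition_hasPropertyS X (half_pos hε)
  have := hP.to_subtype
  refine ⟨range fun p => closure (U p), finite_range _, ?_, ?_, ?_, ?_, ?_⟩
  · rw [sUnion_range, ← closure_iUnion_of_finite, hdense]
  · rintro _ ⟨p, rfl⟩
    exact ⟨isCompact_iff_compactSpace.1 isClosed_closure.isCompact,
      isConnected_iff_connectedSpace.1 (hUc p).closure, inferInstance,
      (hasPropertyS_closure (hUS p)).locallyConnectedSpace isClosed_closure⟩
  · refine iSup₂_le ?_
    rintro _ ⟨p, rfl⟩
    refine (ediam_mono (closure_minimal (hUη p) isClosed_closedBall)).trans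
      (ediam_le_of_forall_dist_le fun x hx y hy => ?_)
    have h1 : dist x p ≤ ε / 2 := hx
    have h2 : dist y p ≤ ε / 2 := hy
    linarith [dist_triangle_right x y p]
  · rintro _ ⟨p, rfl⟩
    exact (hUc p).nonempty.mono (interior_maximal subset_closure (hUo p))
  · rintro _ ⟨p, rfl⟩ _ ⟨q, rfl⟩ hpq
    have hpq' : p ≠ q := fun h => hpq (h ▸ rfl)
    -- An open set inside the closures of both `U p` and `U q` would meet `U p ∩ U q`.
    have h1 : Disjoint (closure (U p)) (U q) := (hd hpq').closure_left (hUo q)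
    have h2 : Disjoint (interior (closure (U p))) (closure (U q)) :=
      (h1.mono_left interior_subset).closure_right isOpen_interior
    exact h2.mono_right interior_subset
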